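/- Let $d\ge 1$ and $k\ge 0$ be integers, let $\varepsilon>0$, and let $x_1,\dots,x_k$ be independent random vectors, each uniformly distributed on the unit sphere $\mathbb S^{d-1}\subset\mathbb R^d$ (with respect to normalized surface measure). Then $$\Pr\bigl(|\langle x_i,x_j\rangle|<\varepsilon\ \text{ for all } i\ne j\bigr)\ \ge\ 1-2\binom{k}{2}e^{-\frac d8\varepsilon^2}.$$ Consequently, exponentially many such random vectors are pairwise $\varepsilon$-orthogonal with high probability, in the following sense: there is a universal constant $C>0$ such that (a) for every $T>0$ there is a constant $c>0$, depending only on $T$, such that for all $d\ge1$, $\varepsilon>0$ and all $k\le c\,e^{Cd\varepsilon^2}$, the vectors satisfy $|\langle x_i,x_j\rangle|<\varepsilon$ for all $i\neq j$ with probability greater than $1-T$; (b) for some universal constant $C'>0$ and for all $d\ge1$, $\varepsilon>0$ and all $k\le e^{Cd\varepsilon^2}$, the vectors satisfy $|\langle x_i,x_j\rangle|<\varepsilon$ for all $i\neq j$ with probability at least $1-e^{-C'd\varepsilon^2}$. -/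

import Mathlib

open MeasureTheory ProbabilityTheory

universe u

/-- The uniform distribution on the unit sphere `𝕊^{d-1}` of `ℝ^d`: the surface measure induced by
Lebesgue measure, normalized to total mass one (a probability measure for every `d ≥ 1`). -/
noncomputable def sphereUniform (d : ℕ) :
    Measure (Metric.sphere (0 : EuclideanSpace ℝ (Fin d)) 1) :=
  ((volume : Measure (EuclideanSpace ℝ (Fin d))).toSphere Set.univ)⁻¹ •
    (volume : Measure (EuclideanSpace ℝ (Fin d))).toSphere

/-- The random vectors `x 0, …, x (k - 1)` are independent and each of them is uniformly
distributed on `𝕊^{d-1}`. -/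
structure IsSphericalCode {Ω : Type u} [MeasurableSpace Ω] (P : Measure Ω) (d k : ℕ)
    (x : Fin k → Ω → Metric.sphere (0 : EuclideanSpace ℝ (Fin d)) 1) : Prop where
  uniform : ∀ i, HasLaw (x i) (sphereUniform d) P
  indep : iIndepFun x P

/-- The vectors `v 0, …, v (k - 1)` of the unit sphere are pairwise `ε`-orthogonal:
`|⟨v i, v j⟩| < ε` whenever `i ≠ j`. -/
def PairwiseEpsOrthogonal {d k : ℕ} (ε : ℝ)
    (v : Fin k → Metric.sphere (0 : EuclideanSpace ℝ (Fin d)) 1) : Prop :=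
  ∀ i j, i ≠ j → |inner ℝ (v i : EuclideanSpace ℝ (Fin d)) (v j)| < ε

/-! Surface measure of a cap is `d` times the volume of the cone over it. That cone fits in a ball
of radius `√(1 - 3ε²/4)`, so the cap's share of the sphere is at most `(1 - 3ε²/4)^(d/2) ≤ exp
(-dε²/8)`. Two opposite caps, Fubini for an independent pair and a union bound over unordered pairs
give the quantitative estimate; the other claims follow from `2 * k.choose 2 ≤ k²`. -/

open scoped Pointwise in
/-- The open cone over a spherical cap of height at least `ε` lies in a ball of squared radius
`1 - 3ε²/4`. -/
theorem cone_cap_subset_closedBall {E : Type*} [NormedAddCommGroup E] [InnerProductSpace ℝ E]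
    {v : E} (hv : ‖v‖ = 1) {ε : ℝ} (hε : 0 < ε) (hε1 : ε ≤ 1) :
    Set.Ioo (0 : ℝ) 1 • ((↑) '' {u : Metric.sphere (0 : E) 1 | ε ≤ inner ℝ (u : E) v}) ⊆
      Metric.closedBall ((ε / 2) • v) (√(1 - 3 * ε ^ 2 / 4)) := by
  rintro _ ⟨r, ⟨hr0, hr1⟩, _, ⟨u, hu, rfl⟩, rfl⟩
  have hu1 : ‖(u : E)‖ = 1 := by simp
  rw [Metric.mem_closedBall, dist_eq_norm]
  apply Real.le_sqrt_of_sq_le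
  simp only [Set.mem_ofPred_eq] at hu ⊢
  rw [norm_sub_sq_real, norm_smul, norm_smul, hu1, hv, inner_smul_left, inner_smul_right,
    Real.norm_of_nonneg hr0.le, Real.norm_of_nonneg (by positivity : 0 ≤ ε / 2)]
  simp only [conj_trivial]
  -- It remains to see `r² - rε² ≤ 1 - ε²`, which follows from `r² ≤ r` and `ε ≤ 1`. The centre
  -- `(ε/2) • v` keeps the apex `0` in the ball for every `ε ≤ 1`.
  have h1 : r * ε * ε ≤ r * ε * inner ℝ (u : E) v := by gcongr
  have h2 : 0 ≤ (1 - r) * (1 - ε * ε) :=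
    mul_nonneg (by linarith) (by nlinarith)
  nlinarith [mul_pos hr0 (sub_pos.2 hr1)]

theorem toSphere_cap_le {d : ℕ} {v : EuclideanSpace ℝ (Fin d)} (hv : ‖v‖ = 1) {ε : ℝ}
    (hε : 0 < ε) :
    (volume : Measure (EuclideanSpace ℝ (Fin d))).toSphere {u | ε ≤ inner ℝ u.1 v} ≤
      ENNReal.ofReal (Real.exp (-((d : ℝ) / 8 * ε ^ 2))) *
        (volume : Measure (EuclideanSpace ℝ (Fin d))).toSphere Set.univ := by
  -- For `ε > 1` the cap is empty by Cauchy–Schwarz.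
  rcases lt_or_ge 1 ε with h1 | h1
  · have : {u : Metric.sphere (0 : EuclideanSpace ℝ (Fin d)) 1 | ε ≤ inner ℝ u.1 v} = ∅ := by
      refine Set.eq_empty_of_forall_notMem fun u hu => ?_
      have h2 := real_inner_le_norm (u : EuclideanSpace ℝ (Fin d)) v
      rw [hv, norm_eq_of_mem_sphere u] at h2
      have h3 : ε ≤ inner ℝ (u : EuclideanSpace ℝ (Fin d)) v := hu
      linarith
    simp [this]
  have hmeas : MeasurableSet
      {u : Metric.sphere (0 : EuclideanSpace ℝ (Fin d)) 1 | ε ≤ inner ℝ u.1 v} :=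
    measurableSet_le measurable_const (by fun_prop)
  rw [Measure.toSphere_apply' _ hmeas, Measure.toSphere_apply_univ, mul_left_comm]
  gcongr
  refine (measure_mono (cone_cap_subset_closedBall hv hε h1)).trans ?_
  rw [Measure.addHaar_closedBall _ _ (Real.sqrt_nonneg _), finrank_euclideanSpace_fin]
  gcongr
  have h4 : √(1 - 3 * ε ^ 2 / 4) ≤ Real.exp (-(ε ^ 2 / 8)) := by
    apply Real.sqrt_le_iff.2 ⟨(Real.exp_pos _).le, ?_⟩
    rw [← Real.exp_nat_mul]
    -- `1 - 3ε²/4 ≤ 1 - ε²/4 ≤ exp (-ε²/4)`; the first inequality is wasteful.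
    have h5 := Real.add_one_le_exp (((2 : ℕ) : ℝ) * -(ε ^ 2 / 8))
    push_cast at h5 ⊢
    nlinarith [sq_nonneg ε]
  calc √(1 - 3 * ε ^ 2 / 4) ^ d ≤ Real.exp (-(ε ^ 2 / 8)) ^ d := by gcongr
    _ = _ := by rw [← Real.exp_nat_mul]; congr 1; ring

theorem toSphere_univ_ne_zero {d : ℕ} (hd : 1 ≤ d) :
    (volume : Measure (EuclideanSpace ℝ (Fin d))).toSphere Set.univ ≠ 0 := by
  have : NeZero d := ⟨by omega⟩
  rw [Measure.measure_univ_ne_zero]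
  exact Measure.toSphere_ne_zero _

theorem isProbabilityMeasure_sphereUniform {d : ℕ} (hd : 1 ≤ d) :
    IsProbabilityMeasure (sphereUniform d) := by
  refine ⟨?_⟩
  rw [sphereUniform, Measure.smul_apply, smul_eq_mul,
    ENNReal.inv_mul_cancel (toSphere_univ_ne_zero hd) (measure_ne_top _ _)]

theorem sphereUniform_cap_le {d : ℕ} (hd : 1 ≤ d) {v : EuclideanSpace ℝ (Fin d)} (hv : ‖v‖ = 1)
    {ε : ℝ} (hε : 0 < ε) :
    sphereUniform d {u | ε ≤ inner ℝ u.1 v} ≤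
      ENNReal.ofReal (Real.exp (-((d : ℝ) / 8 * ε ^ 2))) := by
  rw [sphereUniform, Measure.smul_apply, smul_eq_mul]
  refine (mul_le_mul_right (toSphere_cap_le hv hε) _).trans_eq ?_
  rw [mul_left_comm, ENNReal.inv_mul_cancel (toSphere_univ_ne_zero hd) (measure_ne_top _ _),
    mul_one]

theorem sphereUniform_abs_inner_ge_le {d : ℕ} (hd : 1 ≤ d) {v : EuclideanSpace ℝ (Fin d)}
    (hv : ‖v‖ = 1) {ε : ℝ} (hε : 0 < ε) :
    sphereUniform d {u | ε ≤ |inner ℝ v u.1|} ≤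
      ENNReal.ofReal (2 * Real.exp (-((d : ℝ) / 8 * ε ^ 2))) := by
  have hsub : {u : Metric.sphere (0 : EuclideanSpace ℝ (Fin d)) 1 | ε ≤ |inner ℝ v u.1|} ⊆
      {u | ε ≤ inner ℝ u.1 v} ∪ {u | ε ≤ inner ℝ u.1 (-v)} := fun u hu => by
    simpa [real_inner_comm, le_abs] using hu
  refine (measure_mono hsub).trans ((measure_union_le _ _).trans ?_)
  rw [two_mul, ENNReal.ofReal_add (Real.exp_pos _).le (Real.exp_pos _).le]
  exact add_le_add (sphereUniform_cap_le hd hv hε)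
    (sphereUniform_cap_le hd (by rwa [norm_neg]) hε)

section

variable {Ω : Type*} [MeasurableSpace Ω] {P : Measure Ω} [IsProbabilityMeasure P]

theorem IsSphericalCode.measure_abs_inner_ge_le {d k : ℕ}
    {x : Fin k → Ω → Metric.sphere (0 : EuclideanSpace ℝ (Fin d)) 1}
    (hx : IsSphericalCode P d k x) (hd : 1 ≤ d) {ε : ℝ} (hε : 0 < ε) {i j : Fin k} (hij : i ≠ j) :
    P {ω | ε ≤ |inner ℝ (x i ω : EuclideanSpace ℝ (Fin d)) (x j ω)|} ≤
      ENNReal.ofReal (2 * Real.exp (-((d : ℝ) / 8 * ε ^ 2))) := by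
  have := isProbabilityMeasure_sphereUniform hd
  have hi := (hx.uniform i).aemeasurable
  have hj := (hx.uniform j).aemeasurable
  have hlaw : HasLaw (fun ω => (x i ω, x j ω)) ((sphereUniform d).prod (sphereUniform d)) P := by
    refine ⟨hi.prodMk hj, ?_⟩
    rw [(indepFun_iff_map_prod_eq_prod_map_map hi hj).1 (hx.indep.indepFun hij),
      (hx.uniform i).map_eq, (hx.uniform j).map_eq]
  have hmeas : MeasurableSet {p : Metric.sphere (0 : EuclideanSpace ℝ (Fin d)) 1 ×
      Metric.sphere (0 : EuclideanSpace ℝ (Fin d)) 1 |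
      ε ≤ |inner ℝ (p.1 : EuclideanSpace ℝ (Fin d)) p.2|} :=
    (isClosed_le continuous_const (by fun_prop)).measurableSet
  -- Fubini: with the first vector frozen, the two-cap bound is uniform in it.
  rw [hlaw.measure_eq hmeas, Measure.prod_apply hmeas]
  refine (lintegral_mono fun u =>
    sphereUniform_abs_inner_ge_le hd (norm_eq_of_mem_sphere u) hε).trans_eq ?_
  simp

theorem IsSphericalCode.measure_not_pairwiseEpsOrthogonal_le {d k : ℕ}
    {x : Fin k → Ω → Metric.sphere (0 : EuclideanSpace ℝ (Fin d)) 1}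
    (hx : IsSphericalCode P d k x) (hd : 1 ≤ d) {ε : ℝ} (hε : 0 < ε) :
    P {ω | PairwiseEpsOrthogonal ε (fun i => x i ω)}ᶜ ≤
      ENNReal.ofReal (2 * (k.choose 2 : ℝ) * Real.exp (-((d : ℝ) / 8 * ε ^ 2))) := by
  -- By symmetry of the inner product, pairs `i < j` suffice, hence `k.choose 2` terms.
  have hsub : {ω | PairwiseEpsOrthogonal ε (fun i => x i ω)}ᶜ ⊆
      ⋃ j ∈ Finset.univ, ⋃ i ∈ Finset.Iio j,
        {ω | ε ≤ |inner ℝ (x i ω : EuclideanSpace ℝ (Fin d)) (x j ω)|} := by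
    intro ω hω
    simp only [PairwiseEpsOrthogonal, Set.mem_compl_iff, Set.mem_ofPred_eq, not_forall,
      not_lt] at hω
    obtain ⟨i, j, hij, h⟩ := hω
    simp only [Set.mem_iUnion, Finset.mem_univ, Finset.mem_Iio, exists_prop, true_and,
      Set.mem_ofPred_eq]
    rcases lt_or_gt_of_ne hij with hlt | hlt
    · exact ⟨j, i, hlt, h⟩
    · exact ⟨i, j, hlt, by rwa [real_inner_comm]⟩
  calc P {ω | PairwiseEpsOrthogonal ε (fun i => x i ω)}ᶜ
      ≤ ∑ j : Fin k, ∑ i ∈ Finset.Iio j,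
          P {ω | ε ≤ |inner ℝ (x i ω : EuclideanSpace ℝ (Fin d)) (x j ω)|} :=
        (measure_mono hsub).trans <| (measure_biUnion_finset_le _ _).trans <|
          Finset.sum_le_sum fun j _ => measure_biUnion_finset_le _ _
    _ ≤ ∑ j : Fin k, ∑ i ∈ Finset.Iio j,
          ENNReal.ofReal (2 * Real.exp (-((d : ℝ) / 8 * ε ^ 2))) :=
        Finset.sum_le_sum fun j _ => Finset.sum_le_sum fun i hi =>
          hx.measure_abs_inner_ge_le hd hε (Finset.mem_Iio.1 hi).ne
    _ = (k.choose 2 : ℕ) * ENNReal.ofReal (2 * Real.exp (-((d : ℝ) / 8 * ε ^ 2))) := by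
        simp only [Finset.sum_const, Fin.card_Iio, nsmul_eq_mul]
        rw [← Finset.sum_mul, Fin.sum_univ_eq_sum_range (fun n => (n : ENNReal)), ← Nat.cast_sum,
          Finset.sum_range_id, Nat.choose_two_right]
    _ = _ := by
        rw [← ENNReal.ofReal_natCast, ← ENNReal.ofReal_mul (by positivity)]
        congr 1
        ring

theorem IsSphericalCode.le_measureReal_pairwiseEpsOrthogonal {d k : ℕ}
    {x : Fin k → Ω → Metric.sphere (0 : EuclideanSpace ℝ (Fin d)) 1}
    (hx : IsSphericalCode P d k x) (hd : 1 ≤ d) {ε : ℝ} (hε : 0 < ε) :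
    1 - 2 * (k.choose 2 : ℝ) * Real.exp (-((d : ℝ) / 8 * ε ^ 2)) ≤
      P.real {ω | PairwiseEpsOrthogonal ε (fun i => x i ω)} := by
  have h1 := ENNReal.toReal_le_of_le_ofReal (by positivity)
    (hx.measure_not_pairwiseEpsOrthogonal_le hd hε)
  have h2 := measureReal_union_le (μ := P) {ω | PairwiseEpsOrthogonal ε (fun i => x i ω)}
    {ω | PairwiseEpsOrthogonal ε (fun i => x i ω)}ᶜ
  rw [Set.union_compl_self, probReal_univ] at h2
  rw [← measureReal_def] at h1
  linarith

end

theorem two_mul_choose_two_le_sq (k : ℕ) : 2 * (k.choose 2 : ℝ) ≤ (k : ℝ) ^ 2 := by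
  rw [Nat.cast_choose_two]
  nlinarith [Nat.cast_nonneg (α := ℝ) k]

/-- Squaring the bound on `k` spends half of the exponent `1/8`; the other `1/16` survives as decay.
-/
theorem two_mul_choose_two_mul_exp_le {d k : ℕ} {ε c : ℝ}
    (hk : (k : ℝ) ≤ c * Real.exp (1 / 32 * d * ε ^ 2)) :
    2 * (k.choose 2 : ℝ) * Real.exp (-((d : ℝ) / 8 * ε ^ 2)) ≤
      c ^ 2 * Real.exp (-(1 / 16 * d * ε ^ 2)) := by
  calc 2 * (k.choose 2 : ℝ) * Real.exp (-((d : ℝ) / 8 * ε ^ 2))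
      ≤ (c * Real.exp (1 / 32 * d * ε ^ 2)) ^ 2 * Real.exp (-((d : ℝ) / 8 * ε ^ 2)) := by
        gcongr
        exact (two_mul_choose_two_le_sq k).trans (by gcongr)
    _ = _ := by
        rw [mul_pow, ← Real.exp_nat_mul, mul_assoc, ← Real.exp_add]
        congr 2
        push_cast
        ring

theorem mainTheorem3 :
    -- the quantitative bound
    (∀ (d k : ℕ) (ε : ℝ), 1 ≤ d → 0 < ε →
      ∀ (Ω : Type u) [MeasurableSpace Ω] (P : Measure Ω) [IsProbabilityMeasure P]
        (x : Fin k → Ω → Metric.sphere (0 : EuclideanSpace ℝ (Fin d)) 1),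
        IsSphericalCode P d k x →
        1 - 2 * (k.choose 2 : ℝ) * Real.exp (-((d : ℝ) / 8 * ε ^ 2)) ≤
          P.real {ω | PairwiseEpsOrthogonal ε (fun i => x i ω)}) ∧
    -- exponentially many codes, with a universal exponent `C`
    (∃ C : ℝ, 0 < C ∧
      -- for every fixed error threshold `T`
      (∀ T : ℝ, 0 < T → ∃ c : ℝ, 0 < c ∧
        ∀ (d k : ℕ) (ε : ℝ), 1 ≤ d → 0 < ε → (k : ℝ) ≤ c * Real.exp (C * d * ε ^ 2) →
        ∀ (Ω : Type u) [MeasurableSpace Ω] (P : Measure Ω) [IsProbabilityMeasure P]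
          (x : Fin k → Ω → Metric.sphere (0 : EuclideanSpace ℝ (Fin d)) 1),
          IsSphericalCode P d k x →
          1 - T < P.real {ω | PairwiseEpsOrthogonal ε (fun i => x i ω)}) ∧
      -- with probability exponentially close to one
      (∃ C' : ℝ, 0 < C' ∧
        ∀ (d k : ℕ) (ε : ℝ), 1 ≤ d → 0 < ε → (k : ℝ) ≤ Real.exp (C * d * ε ^ 2) →
        ∀ (Ω : Type u) [MeasurableSpace Ω] (P : Measure Ω) [IsProbabilityMeasure P]
          (x : Fin k → Ω → Metric.sphere (0 : EuclideanSpace ℝ (Fin d)) 1),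
          IsSphericalCode P d k x →
          1 - Real.exp (-(C' * d * ε ^ 2)) ≤
            P.real {ω | PairwiseEpsOrthogonal ε (fun i => x i ω)})) := by
  -- With `c = √(T/2)` the failure probability is at most `T/2`, which makes the bound by `T`
  -- strict.
  refine ⟨fun d k ε hd hε Ω _ P _ x hx => hx.le_measureReal_pairwiseEpsOrthogonal hd hε,
    1 / 32, by norm_num, fun T hT => ⟨√(T / 2), by positivity, ?_⟩, 1 / 16, by norm_num, ?_⟩
  · intro d k ε hd hε hk Ω _ P _ x hx
    have h1 := hx.le_measureReal_pairwiseEpsOrthogonal hd hε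
    have h2 := two_mul_choose_two_mul_exp_le hk
    rw [Real.sq_sqrt (by positivity)] at h2
    have h3 : Real.exp (-(1 / 16 * d * ε ^ 2)) ≤ 1 :=
      Real.exp_le_one_iff.2 (neg_nonpos.2 (by positivity))
    nlinarith
  · intro d k ε hd hε hk Ω _ P _ x hx
    have h1 := hx.le_measureReal_pairwiseEpsOrthogonal hd hε
    have h2 := two_mul_choose_two_mul_exp_le (c := 1) (by rwa [one_mul])
    rw [one_pow, one_mul] at h2
    linarith
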